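/- Let $n\ge 0$ be an integer, $t_0<T$, $1\le p<\infty$, and let $|\cdot|$ be the Euclidean norm on $\mathbb R^n$; $L_p^n[t_0,T]$ is the space of (classes of) measurable $u:[t_0,T]\to\mathbb R^n$ with $\|u\|_{L_p^n}=\big(\int_{t_0}^T|u(t)|^p\,dt\big)^{1/p}<\infty$, and $C^n[t_0,T]$ is the space of continuous functions $[t_0,T]\to\mathbb R^n$. Let $B(x,\alpha)=\{y:|y-x|\le\alpha\}$. Let - $A:L_p^n[t_0,T]\to C^n[t_0,T]$ be an operator, not necessarily linear; - $\varphi:\mathbb R^n\times\mathbb R^n\to\mathbb R\cup\{+\infty\}$ be a function; - $f:[t_0,T]\times\mathbb R^n\times\mathbb R^n\to\mathbb R\cup\{+\infty\}$ be a normal integrand (for every $t$ the epigraph of $f(t,\cdot,\cdot)$ is closed, and it depends measurably on $t$); - $F$ assign to each $(t,x)\in[t_0,T]\times\mathbb R^n$ a compact, possibly empty, set $F(t,x)\subset\mathbb R^n$, with $t\mapsto F(t,x)$ Lebesgue measurable for each $x$. Put $$J(u)=\varphi\big((Au)(t_0),(Au)(T)\big)+\int_{t_0}^T f\big(t,(Au)(t),u(t)\big)\,dt,\qquad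 u\in L_p^n[t_0,T]$$ (with $(+\infty)+(-\infty)=+\infty$), $\psi(t,x,y)=\inf\{|z-y|:z\in F(t,x)\}$ (with $\inf\emptyset=+\infty$), and for $r>0$ $$J_r(u)=J(u)+r\Big(\int_{t_0}^T\psi^p\big(t,(Au)(t),u(t)\big)\,dt\Big)^{1/p}.$$ Let $\bar u\in L_p^n[t_0,T]$ solve the problem of minimizing $J(u)$ subject to $u\in L_p^n[t_0,T]$, $u(t)\in F(t,(Au)(t))$ for a.e. $t$; that is, $\bar u$ satisfies the inclusion, $|J(\bar u)|<\infty$, and $J(\bar u)\le J(u)$ for every $u\in L_p^n[t_0,T]$ satisfying the inclusion. Assume that there are $k\in L_1[t_0,T]$, $M\in L_p[t_0,T]$ and numbers $k_1,k_2,\alpha,L>0$ such that, for a.e. $t\in[t_0,T]$, $F(t,x)\neq\emptyset$ for all $x\in B((A\bar u)(t),\alpha)$ and $$|f(t,x_1,y_1)-f(t,x_2,y_2)|\le k(t)|x_1-x_2|+k_1|y_1-y_2|,\qquad \rho\big(F(t,x_1),F(t,x_2)\big)\le M(t)|x_1-x_2|$$ for all $x_1,x_2\in B((A\bar u)(t),\alpha)$,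 $y_1,y_2\in\mathbb R^n$, where $\rho$ is the Hausdorff distance; that $$|\varphi(z_2,w_2)-\varphi(z_1,w_1)|\le k_2\big(|z_2-z_1|+|w_2-w_1|\big)$$ for all $z_1,z_2\in B((A\bar u)(t_0),\alpha)$, $w_1,w_2\in B((A\bar u)(T),\alpha)$; that $|(Au)(t)-(Av)(t)|\le L\|u-v\|_{L_p^n}$ for all $u,v\in L_p^n[t_0,T]$ and $t\in[t_0,T]$; and that $L\|M\|_p<1$, where $\|M\|_p=\big(\int_{t_0}^T |M(t)|^p\,dt\big)^{1/p}$. Let $\tilde p=p-1$ if $p\in\mathbb N$ and $\tilde p=p$ otherwise. Then there is $r_0>0$ such that, for every number $$\beta\ \ge\ \frac{L\,3^{(2\tilde p+2)/p}\,\big(L\|M\|_p+1\big)}{1-L\|M\|_p}+L+1$$ and every $r\ge r_0$, the function $\bar u$ minimizes $J_r$ on the ball $D=\big\{u\in L_p^n[t_0,T]:\|u-\bar u\|_{L_p^n}\le \alpha/\beta\big\}$. -/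

import Mathlib

open MeasureTheory Set
open scoped ENNReal

-- Lebesgue measure on the segment `[t₀, T]`
attribute [local instance] MeasureTheory.Measure.Subtype.measureSpace

noncomputable section

/-- The Euclidean space `ℝⁿ`. -/
abbrev Euc (n : ℕ) : Type := EuclideanSpace ℝ (Fin n)

/-- The space `L_pⁿ[t₀, T]` for a real exponent `p` (Lebesgue measure on the segment). -/
abbrev LpSeg (n : ℕ) (t₀ T p : ℝ) : Type :=
  Lp (Euc n) (ENNReal.ofReal p) (volume : Measure (Icc t₀ T))

/-- The space `Cⁿ[t₀, T]`. -/
abbrev CSeg (n : ℕ) (t₀ T : ℝ) : Type := C(Icc t₀ T, Euc n)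

/-- Addition of extended reals with the usual convention of minimization problems,
`(+∞) + (-∞) = +∞` (Mathlib's `+` gives `-∞` there; it agrees with this one otherwise). -/
def upperAdd (a b : EReal) : EReal := -(-a + -b)

/-- Lebesgue measurability of a multivalued map `t ↦ Γ t`: the set of those `t` for which `Γ t`
meets `U` is Lebesgue measurable, for every open set `U`. -/
def MeasurableMultimap {Ω X : Type*} [MeasureSpace Ω] [TopologicalSpace X]
    (Γ : Ω → Set X) : Prop :=
  ∀ U : Set X, IsOpen U → NullMeasurableSet {t | (Γ t ∩ U).Nonempty} (volume : Measure Ω)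

/-- The epigraph of `f(t, ·, ·)`, a subset of `(ℝⁿ × ℝⁿ) × ℝ`. -/
def epigraphAt {Ω : Type*} {n : ℕ} (f : Ω → Euc n → Euc n → EReal) (t : Ω) :
    Set ((Euc n × Euc n) × ℝ) :=
  {q | f t q.1.1 q.1.2 ≤ (q.2 : EReal)}

/-- A normal integrand with values in `ℝ ∪ {+∞}`: for each `t` the epigraph of `f(t, ·, ·)` is
closed, and it depends measurably on `t`. -/
structure IsNormalIntegrand {Ω : Type*} [MeasureSpace Ω] {n : ℕ}
    (f : Ω → Euc n → Euc n → EReal) : Prop where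
  ne_bot : ∀ t x y, f t x y ≠ ⊥
  closed_epigraph : ∀ t, IsClosed (epigraphAt f t)
  measurable_epigraph : MeasurableMultimap (epigraphAt f)

/-- The Lebesgue integral of an extended real function, `∫ g⁺ - ∫ g⁻`, with value `+∞` if
both integrals are infinite. -/
def extIntegral {Ω : Type*} [MeasureSpace Ω] (g : Ω → EReal) : EReal :=
  upperAdd ((∫⁻ t, (g t).toENNReal : ℝ≥0∞) : EReal)
    (-((∫⁻ t, (-g t).toENNReal : ℝ≥0∞) : EReal))

/-- The functional `J(u) = φ((Au)(t₀), (Au)(T)) + ∫ f(t, (Au)(t), u(t)) dt`. -/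
def objective {n : ℕ} {t₀ T p : ℝ} (hT : t₀ < T) (A : LpSeg n t₀ T p → CSeg n t₀ T)
    (φ : Euc n → Euc n → EReal) (f : Icc t₀ T → Euc n → Euc n → EReal)
    (u : LpSeg n t₀ T p) : EReal :=
  upperAdd (φ (A u ⟨t₀, left_mem_Icc.2 hT.le⟩) (A u ⟨T, right_mem_Icc.2 hT.le⟩))
    (extIntegral fun t => f t (A u t) (u t))

/-- `u` solves the inclusion `u(t) ∈ F(t, (Au)(t))` (almost everywhere). -/
def SolvesInclusion {n : ℕ} {t₀ T p : ℝ} (A : LpSeg n t₀ T p → CSeg n t₀ T)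
    (F : Icc t₀ T → Euc n → Set (Euc n)) (u : LpSeg n t₀ T p) : Prop :=
  ∀ᵐ t : Icc t₀ T, u t ∈ F t (A u t)

/-- `ubar` solves the extremal problem: it solves the inclusion, `J(ubar)` is finite, and
`J(ubar) ≤ J(u)` for every solution `u` of the inclusion. -/
structure SolvesExtremalProblem {n : ℕ} {t₀ T p : ℝ} (hT : t₀ < T)
    (A : LpSeg n t₀ T p → CSeg n t₀ T) (φ : Euc n → Euc n → EReal)
    (f : Icc t₀ T → Euc n → Euc n → EReal) (F : Icc t₀ T → Euc n → Set (Euc n))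
    (ubar : LpSeg n t₀ T p) : Prop where
  solves : SolvesInclusion A F ubar
  ne_top : objective hT A φ f ubar ≠ ⊤
  ne_bot : objective hT A φ f ubar ≠ ⊥
  le_of_solves : ∀ u, SolvesInclusion A F u → objective hT A φ f ubar ≤ objective hT A φ f u

/-- `ψ(t, x, y) = inf {|z - y| : z ∈ F(t, x)}`, which is `+∞` when `F(t, x)` is empty. -/
def psi {Ω : Type*} {n : ℕ} (F : Ω → Euc n → Set (Euc n)) (t : Ω) (x y : Euc n) : ℝ≥0∞ :=
  Metric.infEDist y (F t x)

/-- The penalized functional `J_r(u) = J(u) + r (∫ ψ(t, (Au)(t), u(t))^p dt)^{1/p}`. -/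
def penalized {n : ℕ} {t₀ T p : ℝ} (hT : t₀ < T) (A : LpSeg n t₀ T p → CSeg n t₀ T)
    (φ : Euc n → Euc n → EReal) (f : Icc t₀ T → Euc n → Euc n → EReal)
    (F : Icc t₀ T → Euc n → Set (Euc n)) (r : ℝ) (u : LpSeg n t₀ T p) : EReal :=
  upperAdd (objective hT A φ f u)
    ((r : EReal) * (((∫⁻ t : Icc t₀ T, psi F t (A u t) (u t) ^ p) ^ (1 / p) : ℝ≥0∞) : EReal))

open scoped Classical in
/-- `p̃ = p - 1` if `p` is a natural number, `p̃ = p` otherwise. -/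
def pTilde (p : ℝ) : ℝ := if ∃ m : ℕ, (m : ℝ) = p then p - 1 else p

end

open Filter Topology

/-! This is exact penalization by an error bound. Put `m = L‖M‖_p < 1`, and let the defect of `u` be
the `L_p` norm of `ψ(t, (Au)(t), u(t))`. On the ball of radius `α/L` about `ubar`, where
trajectories stay within `α` of that of `ubar`, the objective is Lipschitz with some constant `C`
(`exists_objective_le_add`). If `u` is close enough to `ubar`, some solution `v` of the inclusion in
that ball satisfies `‖v - u‖ ≤ 4/(1-m) · defect u` (`exists_solvesInclusion_near`). Hence `J(ubar) ≤
J(v) ≤ J(u) + C · 4/(1-m) · defect u`, and the penalty dominates the last term for large `r`.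

The error bound is a Filippov-type iteration. Replacing `u` by a measurable, almost nearest
selection of `F(t, (Au)(t))` moves it by about its defect `d`. The trajectory then moves by about `L
d` and the set `F` by `|M(t)| L d`, so the new defect is about `m d` (`exists_defect_le`). The steps
sum geometrically and the defect is continuous, so the limit has defect zero
(`exists_zero_of_contracting_steps`). The bound on `β` keeps the whole iteration inside the ball of
radius `α/L`. -/

/-! ### Measurability of distance functions and approximate selections -/

theorem MeasurableMultimap.aemeasurable_infEDist {Ω X : Type*} [MeasureSpace Ω]
    [PseudoEMetricSpace X] {Γ : Ω → Set X} (hΓ : MeasurableMultimap Γ) (y : X) :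
    AEMeasurable (fun t => Metric.infEDist y (Γ t)) (volume : Measure Ω) := by
  apply NullMeasurable.aemeasurable
  have key : @Measurable (NullMeasurableSpace Ω volume) ℝ≥0∞ _ _
      (fun t => Metric.infEDist y (Γ t)) := by
    apply measurable_of_Iio
    intro c
    have h := hΓ (Metric.eball y c) Metric.isOpen_eball
    have heq : (fun t => Metric.infEDist y (Γ t)) ⁻¹' Iio c
        = {t | (Γ t ∩ Metric.eball y c).Nonempty} := by
      ext t
      simp only [mem_preimage, mem_Iio, Metric.infEDist_lt_iff, mem_ofPred_eq, Set.Nonempty,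
        mem_inter_iff, Metric.mem_eball']
    exact (congrArg (fun s => NullMeasurableSet s (volume : Measure Ω)) heq).mpr h
  exact fun s hs => key hs

/-- Superposition with a measurable map: measurability in the first variable and continuity in
the second at the points of the graph suffice. -/
theorem aemeasurable_superposition {Ω E : Type*} [MeasurableSpace Ω] {μ : Measure Ω}
    [TopologicalSpace E] [TopologicalSpace.PseudoMetrizableSpace E] [SecondCountableTopology E]
    [MeasurableSpace E] [BorelSpace E] {g : E → Ω → ℝ≥0∞}
    (hg : ∀ e, AEMeasurable (g e) μ) {x : Ω → E} (hx : AEMeasurable x μ)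
    (hc : ∀ᵐ t ∂μ, ContinuousAt (fun e => g e t) (x t)) :
    AEMeasurable (fun t => g (x t) t) μ := by
  have hm := hx.measurable_mk.stronglyMeasurable
  apply aemeasurable_of_tendsto_metrizable_ae atTop (f := fun k t => g (hm.approx k t) t)
  · intro k
    refine ⟨fun t => (hg (hm.approx k t)).mk _ t,
      SimpleFunc.measurable_bind _ _ fun e => (hg e).measurable_mk, ?_⟩
    -- A simple function takes finitely many values, so only finitely many exceptional null sets are
    -- merged.
    have h : ∀ᵐ t ∂μ, ∀ e ∈ (hm.approx k).range, g e t = (hg e).mk _ t :=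
      (Finset.eventually_all _).2 fun e _ => (hg e).ae_eq_mk
    filter_upwards [h] with t ht
    exact ht _ (SimpleFunc.mem_range_self _ _)
  · filter_upwards [hc, hx.ae_eq_mk] with t ht hxt
    have h1 := hm.tendsto_approx t
    rw [← hxt] at h1
    exact ht.tendsto.comp h1

theorem exists_measurable_index {Ω : Type*} [MeasurableSpace Ω] {μ : Measure Ω}
    {S : ℕ → Set Ω} (hS : ∀ j, NullMeasurableSet (S j) μ) (h : ∀ᵐ t ∂μ, ∃ j, t ∈ S j) :
    ∃ i : Ω → ℕ, Measurable i ∧ ∀ᵐ t ∂μ, t ∈ S (i t) := by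
  classical
  choose S' hsub hmeas hae using fun j => (hS j).exists_measurable_subset_ae_eq
  -- The second alternative makes the least index exist everywhere; it matters only on a null set.
  let P : ℕ → Ω → Prop := fun j t => t ∈ S' j ∨ t ∉ ⋃ j, S' j
  have hPm : ∀ j, MeasurableSet {t | P j t} := fun j =>
    (hmeas j).union (MeasurableSet.iUnion hmeas).compl
  have hP : ∀ t, ∃ j, P j t := by
    intro t
    by_cases ht : t ∈ ⋃ j, S' j
    · obtain ⟨j, hj⟩ := mem_iUnion.1 ht
      exact ⟨j, Or.inl hj⟩
    · exact ⟨0, Or.inr ht⟩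
  refine ⟨fun t => Nat.find (hP t), Measurable.find (f := fun j _ => j)
    (p := P)
    (fun _ => measurable_const) hPm hP, ?_⟩
  have hae' : ∀ᵐ t ∂μ, ∀ j, t ∈ S j → t ∈ S' j :=
    ae_all_iff.2 fun j => (hae j).symm.le
  filter_upwards [h, hae'] with t ⟨j, hj⟩ ht
  rcases Nat.find_spec (hP t) with h1 | h1
  · exact hsub _ h1
  · exact absurd (mem_iUnion.2 ⟨j, ht j hj⟩) h1

/-- An approximate measurable selection of almost nearest points. -/
theorem exists_measurable_almost_nearest {Ω E : Type*} [MeasurableSpace Ω] {μ : Measure Ω}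
    [PseudoEMetricSpace E] [SecondCountableTopology E] [Nonempty E]
    [MeasurableSpace E] [BorelSpace E] {Γ : Ω → Set E}
    (hΓ : ∀ y : Ω → E, AEMeasurable y μ → AEMeasurable (fun t => Metric.infEDist (y t) (Γ t)) μ)
    {u : Ω → E} (hu : AEMeasurable u μ) (hfin : ∀ᵐ t ∂μ, Metric.infEDist (u t) (Γ t) ≠ ⊤)
    {ε : ℝ≥0∞} (hε : ε ≠ 0) :
    ∃ w : Ω → E, Measurable w ∧ ∀ᵐ t ∂μ,
      edist (w t) (u t) ≤ Metric.infEDist (u t) (Γ t) + ε ∧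
        Metric.infEDist (w t) (Γ t) ≤ ε := by
  let q := TopologicalSpace.denseSeq E
  -- Both conditions are open in the point, so an almost nearest point of `Γ t` can be replaced by a
  -- member of the dense sequence. The price is that the selection is only `ε`-close to `Γ t`.
  let S : ℕ → Set Ω := fun j => {t | edist (q j) (u t) < Metric.infEDist (u t) (Γ t) + ε} ∩
    {t | Metric.infEDist (q j) (Γ t) < ε}
  have hS : ∀ j, NullMeasurableSet (S j) μ := fun j =>
    (nullMeasurableSet_lt (aemeasurable_const.edist hu) ((hΓ u hu).add_const ε)).inter
      (nullMeasurableSet_lt (hΓ _ aemeasurable_const) aemeasurable_const)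
  obtain ⟨i, hi, hiS⟩ := exists_measurable_index hS (by
    filter_upwards [hfin] with t ht
    obtain ⟨z, hz, hzu⟩ := Metric.infEDist_lt_iff.1 (ENNReal.lt_add_right ht hε)
    have hopen : IsOpen ({y | edist y (u t) < Metric.infEDist (u t) (Γ t) + ε} ∩
        {y | Metric.infEDist y (Γ t) < ε}) :=
      (isOpen_lt (by fun_prop) continuous_const).inter
        (isOpen_lt Metric.continuous_infEDist continuous_const)
    obtain ⟨j, hj⟩ := (TopologicalSpace.denseRange_denseSeq E).exists_mem_open hopen
      ⟨z, by rw [edist_comm] at hzu; exact hzu, by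
        simpa [Metric.infEDist_zero_of_mem hz] using pos_iff_ne_zero.2 hε⟩
    exact ⟨j, hj⟩)
  refine ⟨fun t => q (i t), (measurable_from_top (f := q)).comp hi, ?_⟩
  filter_upwards [hiS] with t ht
  exact ⟨ht.1.le, ht.2.le⟩

/-! ### Iteration in a complete metric space -/

/-- If from every point near `c` a step proportional to the defect `D` contracts the defect, then
`D` vanishes somewhere, at a distance proportional to the initial defect. -/
theorem exists_zero_of_contracting_steps {X : Type*} [MetricSpace X] [CompleteSpace X]
    {c : X} {R q : ℝ} (hq0 : 0 ≤ q) (hq1 : q < 1) {D : X → ℝ} (hD0 : ∀ u, 0 ≤ D u)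
    (hD : ContinuousOn D (Metric.ball c R))
    (hstep : ∀ u, dist u c + 2 / (1 - q) * D u < R →
      ∃ u', dist u u' ≤ 2 * D u ∧ D u' ≤ q * D u)
    {u : X} (hu : dist u c + 2 / (1 - q) * D u < R) :
    ∃ v, v ∈ Metric.ball c R ∧ D v = 0 ∧ dist u v ≤ 2 / (1 - q) * D u := by
  have hq : 0 < 1 - q := by linarith
  choose! g hg1 hg2 using hstep
  let s : ℕ → X := fun k => g^[k] u
  have hs : ∀ k, s (k + 1) = g (s k) := fun k => Function.iterate_succ_apply' g k u
  -- The term `2 / (1 - q) * D` is the total length of all remaining steps: a step spends at most `2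
  -- * D` and lowers this reserve by at least as much.
  have hinv : ∀ k, dist (s k) c + 2 / (1 - q) * D (s k) < R := by
    intro k
    induction k with
    | zero => exact hu
    | succ k ih =>
      rw [hs]
      have h1 := hg1 _ ih
      have h2 := hg2 _ ih
      have h3 : dist (g (s k)) c ≤ dist (s k) (g (s k)) + dist (s k) c := by
        rw [dist_comm (s k) (g (s k))]; exact dist_triangle _ _ _
      have h4 : 2 / (1 - q) * D (g (s k)) ≤ 2 / (1 - q) * (q * D (s k)) :=
        mul_le_mul_of_nonneg_left h2 (by positivity)
      have h5 : 2 * D (s k) + 2 / (1 - q) * (q * D (s k)) = 2 / (1 - q) * D (s k) := by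
        field_simp; ring
      linarith
  have hDk : ∀ k, D (s k) ≤ D u * q ^ k := by
    intro k
    induction k with
    | zero => simp [s]
    | succ k ih =>
      rw [hs]
      calc D (g (s k)) ≤ q * D (s k) := hg2 _ (hinv k)
        _ ≤ q * (D u * q ^ k) := mul_le_mul_of_nonneg_left ih hq0
        _ = D u * q ^ (k + 1) := by ring
  have hdist : ∀ k, dist (s k) (s (k + 1)) ≤ 2 * D u * q ^ k := by
    intro k
    rw [hs]
    linarith [hg1 _ (hinv k), hDk k]
  obtain ⟨v, hv⟩ := cauchySeq_tendsto_of_complete (cauchySeq_of_le_geometric q _ hq1 hdist)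
  have huv : dist u v ≤ 2 / (1 - q) * D u := by
    have := dist_le_of_le_geometric_of_tendsto₀ q _ hq1 hdist hv
    rwa [mul_div_right_comm] at this
  have hvc : v ∈ Metric.ball c R := by
    rw [Metric.mem_ball]
    have h := dist_triangle v u c
    rw [dist_comm v u] at h
    linarith
  refine ⟨v, hvc, ?_, huv⟩
  have h1 : Tendsto (fun k => D (s k)) atTop (𝓝 (D v)) :=
    (hD.continuousAt (Metric.isOpen_ball.mem_nhds hvc)).tendsto.comp hv
  have h2 : Tendsto (fun k => D (s k)) atTop (𝓝 0) := by
    refine squeeze_zero (fun k => hD0 _) hDk ?_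
    simpa using (tendsto_pow_atTop_nhds_zero_of_lt_one hq0 hq1).const_mul (D u)
  exact tendsto_nhds_unique h1 h2

/-! ### Extended real arithmetic and the extended integral -/

theorem EReal.toENNReal_le_add_ofReal {a b : EReal} {c : ℝ} (h : a ≤ b + c) :
    a.toENNReal ≤ b.toENNReal + ENNReal.ofReal c := by
  simpa using (EReal.toENNReal_le_toENNReal h).trans EReal.toENNReal_add_le

theorem upperAdd_coe (a : EReal) (c : ℝ) : upperAdd a c = a + c := by
  induction a with
  | bot => simp [upperAdd]
  | top => simp [upperAdd]
  | coe a => simp only [upperAdd]; norm_cast; ring_nf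

theorem upperAdd_le_upperAdd_add_coe {a b a' b' : EReal} {c d : ℝ} (ha : a' ≤ a + c)
    (hb : b' ≤ b + d) : upperAdd a' b' ≤ upperAdd a b + ((c + d : ℝ) : EReal) := by
  induction a with
  | top => simp [upperAdd]
  | bot =>
    obtain rfl : a' = ⊥ := by simpa using ha
    induction b with
    | top => simp [upperAdd]
    | bot =>
      obtain rfl : b' = ⊥ := by simpa using hb
      simp [upperAdd]
    | coe b =>
      have : b' ≠ ⊤ := fun h => by
        rw [h, ← EReal.coe_add] at hb
        exact absurd hb (not_le.2 (EReal.coe_lt_top _))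
      induction b' <;> simp_all [upperAdd]
  | coe a =>
    have ha' : a' ≠ ⊤ := fun h => by
      rw [h, ← EReal.coe_add] at ha
      exact absurd ha (not_le.2 (EReal.coe_lt_top _))
    induction b with
    | top => simp [upperAdd]
    | bot =>
      obtain rfl : b' = ⊥ := by simpa using hb
      induction a' <;> simp_all [upperAdd]
    | coe b =>
      have hb' : b' ≠ ⊤ := fun h => by
        rw [h, ← EReal.coe_add] at hb
        exact absurd hb (not_le.2 (EReal.coe_lt_top _))
      induction a' <;> induction b' <;> simp_all [upperAdd]
      norm_cast at *
      linarith

theorem EReal.neg_le_neg_add_coe {x y : EReal} {c : ℝ} (h : x ≤ y + c) : -y ≤ -x + c := by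
  induction y with
  | top => simp
  | bot =>
    obtain rfl : x = ⊥ := by simpa using h
    simp
  | coe y =>
    have : x ≠ ⊤ := fun hx => by
      rw [hx, ← EReal.coe_add] at h
      exact absurd h (not_le.2 (EReal.coe_lt_top _))
    induction x <;> simp_all
    norm_cast at *
    linarith

/-- Either part may have infinite integral, so the positive and negative parts are compared
separately. Each comparison costs `c`, whence `2 * c`. Measurability is needed only for `ℓ`. -/
theorem extIntegral_le_add {Ω : Type*} [MeasureSpace Ω] {g h : Ω → EReal} {ℓ : Ω → ℝ}
    (hℓ : AEMeasurable ℓ) {c : ℝ} (hc0 : 0 ≤ c)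
    (hc : ∫⁻ t, ENNReal.ofReal (ℓ t) ≤ ENNReal.ofReal c)
    (hgh : ∀ᵐ t, g t ≤ h t + ℓ t) :
    extIntegral g ≤ extIntegral h + ((2 * c : ℝ) : EReal) := by
  have key : ∀ a b : Ω → EReal, (∀ᵐ t, a t ≤ b t + ℓ t) →
      ∫⁻ t, (a t).toENNReal ≤ (∫⁻ t, (b t).toENNReal) + ENNReal.ofReal c := by
    intro a b hab
    calc ∫⁻ t, (a t).toENNReal ≤ ∫⁻ t, ((b t).toENNReal + ENNReal.ofReal (ℓ t)) := by
          apply lintegral_mono_ae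
          filter_upwards [hab] with t ht
          exact EReal.toENNReal_le_add_ofReal ht
      _ = (∫⁻ t, (b t).toENNReal) + ∫⁻ t, ENNReal.ofReal (ℓ t) :=
          lintegral_add_right' _ hℓ.ennreal_ofReal
      _ ≤ _ := by gcongr
  have hP := key g h hgh
  have hN := key (fun t => -h t) (fun t => -g t) (by
    filter_upwards [hgh] with t ht
    exact EReal.neg_le_neg_add_coe ht)
  unfold extIntegral
  generalize (∫⁻ t, (g t).toENNReal : ℝ≥0∞) = Pg at *
  generalize (∫⁻ t, (h t).toENNReal : ℝ≥0∞) = Ph at *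
  generalize (∫⁻ t, (-g t).toENNReal : ℝ≥0∞) = Ng at *
  generalize (∫⁻ t, (-h t).toENNReal : ℝ≥0∞) = Nh at *
  rw [two_mul]
  apply upperAdd_le_upperAdd_add_coe
  · have := EReal.coe_ennreal_le_coe_ennreal_iff.2 hP
    rwa [EReal.coe_ennreal_add, EReal.coe_ennreal_ofReal, max_eq_left hc0] at this
  · have := EReal.coe_ennreal_le_coe_ennreal_iff.2 hN
    rw [EReal.coe_ennreal_add, EReal.coe_ennreal_ofReal, max_eq_left hc0] at this
    exact EReal.neg_le_neg_add_coe this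

/-! ### Lipschitz dependence of `ψ` and its consequences -/

/-- For almost all `t` the function `ψ(t, ·, ·)` is finite and Lipschitz near `a t`, with constant
`1` in the velocity and constant `|M t|` in the position. -/
def LipschitzPsi {Ω : Type*} [MeasureSpace Ω] {n : ℕ} (F : Ω → Euc n → Set (Euc n))
    (a : Ω → Euc n) (α : ℝ) (M : Ω → ℝ) : Prop :=
  ∀ᵐ t : Ω, ∀ x₁ ∈ Metric.closedBall (a t) α, ∀ y₁, psi F t x₁ y₁ ≠ ⊤ ∧
    ∀ x₂ ∈ Metric.closedBall (a t) α, ∀ y₂,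
      psi F t x₁ y₁ ≤ psi F t x₂ y₂ + edist y₁ y₂ + ‖M t‖ₑ * edist x₁ x₂

theorem lipschitzPsi_of_hausdorffDist_le {Ω : Type*} [MeasureSpace Ω] {n : ℕ}
    {F : Ω → Euc n → Set (Euc n)} (hF_compact : ∀ t x, IsCompact (F t x)) {a : Ω → Euc n} {α : ℝ}
    {M : Ω → ℝ} (hF_dom : ∀ᵐ t : Ω, ∀ x ∈ Metric.closedBall (a t) α, (F t x).Nonempty)
    (hF_lip : ∀ᵐ t : Ω, ∀ x₁ ∈ Metric.closedBall (a t) α, ∀ x₂ ∈ Metric.closedBall (a t) α,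
      Metric.hausdorffDist (F t x₁) (F t x₂) ≤ M t * ‖x₁ - x₂‖) :
    LipschitzPsi F a α M := by
  filter_upwards [hF_dom, hF_lip] with t hd hl x₁ hx₁ y₁
  refine ⟨Metric.infEDist_ne_top (hd _ hx₁), fun x₂ hx₂ y₂ => ?_⟩
  have h1 : psi F t x₁ y₁ ≤ psi F t x₁ y₂ + edist y₁ y₂ := Metric.infEDist_le_infEDist_add_edist
  have h2 : psi F t x₁ y₂ ≤ psi F t x₂ y₂ + Metric.hausdorffEDist (F t x₂) (F t x₁) :=
    Metric.infEDist_le_infEDist_add_hausdorffEDist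
  -- `Metric.hausdorffDist` defaults to `0` when the extended distance is infinite; finiteness is
  -- what gives the Lipschitz hypothesis its content.
  have hne := Metric.hausdorffEDist_ne_top_of_nonempty_of_bounded (hd _ hx₂) (hd _ hx₁)
    (hF_compact t x₂).isBounded (hF_compact t x₁).isBounded
  have h3 : Metric.hausdorffEDist (F t x₂) (F t x₁) ≤ ‖M t‖ₑ * edist x₁ x₂ := by
    rw [← ENNReal.ofReal_toReal hne, edist_dist, ← ofReal_norm,
      ← ENNReal.ofReal_mul (norm_nonneg _)]
    apply ENNReal.ofReal_le_ofReal
    calc Metric.hausdorffDist (F t x₂) (F t x₁) ≤ M t * ‖x₂ - x₁‖ := hl _ hx₂ _ hx₁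
      _ ≤ ‖M t‖ * dist x₁ x₂ := by
        rw [dist_comm, dist_eq_norm]
        gcongr
        exact Real.le_norm_self _
  calc psi F t x₁ y₁ ≤ psi F t x₂ y₂ + ‖M t‖ₑ * edist x₁ x₂ + edist y₁ y₂ :=
        h1.trans (by gcongr; exact h2.trans (by gcongr))
    _ = _ := add_right_comm _ _ _

theorem LipschitzPsi.aemeasurable {Ω : Type*} [MeasureSpace Ω] {n : ℕ}
    {F : Ω → Euc n → Set (Euc n)} {a : Ω → Euc n} {α : ℝ} {M : Ω → ℝ}
    (h : LipschitzPsi F a α M) (hF_meas : ∀ x, MeasurableMultimap fun t => F t x)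
    {x y : Ω → Euc n} (hx : AEMeasurable x) (hy : AEMeasurable y)
    (hxa : ∀ᵐ t, x t ∈ Metric.ball (a t) α) :
    AEMeasurable (fun t => psi F t (x t) (y t)) := by
  have hg : ∀ e : Euc n × Euc n, AEMeasurable (fun t => psi F t e.1 e.2) volume :=
    fun e => (hF_meas e.1).aemeasurable_infEDist e.2
  refine aemeasurable_superposition (x := fun t => (x t, y t)) hg (hx.prodMk hy) ?_
  filter_upwards [h, hxa] with t ht hxt
  -- The open ball in `hxa` leaves room for a whole neighbourhood on which the Lipschitz bound holds
  -- in both directions.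
  have hnear : ∀ᶠ e : Euc n × Euc n in 𝓝 (x t, y t), e.1 ∈ Metric.closedBall (a t) α :=
    (continuous_fst.tendsto (x t, y t)).eventually
      (mem_of_superset (Metric.isOpen_ball.mem_nhds hxt) Metric.ball_subset_closedBall)
  have hgap : Tendsto (fun e : Euc n × Euc n => edist (y t) e.2 + ‖M t‖ₑ * edist (x t) e.1)
      (𝓝 (x t, y t)) (𝓝 0) := by
    have h1 : Tendsto (fun e : Euc n × Euc n => edist (y t) e.2) (𝓝 (x t, y t)) (𝓝 0) := by
      have : Continuous fun e : Euc n × Euc n => edist (y t) e.2 := by fun_prop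
      simpa using this.tendsto (x t, y t)
    have h2 : Tendsto (fun e : Euc n × Euc n => edist (x t) e.1) (𝓝 (x t, y t)) (𝓝 0) := by
      have : Continuous fun e : Euc n × Euc n => edist (x t) e.1 := by fun_prop
      simpa using this.tendsto (x t, y t)
    simpa using h1.add (ENNReal.Tendsto.const_mul h2 (Or.inr enorm_ne_top))
  have hx' := Metric.ball_subset_closedBall hxt
  have hfin := (ht _ hx' (y t)).1
  refine tendsto_of_tendsto_of_tendsto_of_le_of_le'
    (g := fun e => psi F t (x t) (y t) - (edist (y t) e.2 + ‖M t‖ₑ * edist (x t) e.1))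
    (h := fun e => psi F t (x t) (y t) + (edist (y t) e.2 + ‖M t‖ₑ * edist (x t) e.1)) ?_ ?_ ?_ ?_
  · simpa using ENNReal.Tendsto.sub tendsto_const_nhds hgap (Or.inl hfin)
  · simpa using tendsto_const_nhds.add hgap
  · filter_upwards [hnear] with e he
    rw [tsub_le_iff_right, ← add_assoc]
    exact (ht _ hx' (y t)).2 _ he _
  · filter_upwards [hnear] with e he
    rw [← add_assoc, edist_comm (y t), edist_comm (x t)]
    exact (ht _ he _).2 _ hx' _

/-- Minkowski's inequality applied to the pointwise Lipschitz bound. It serves both for continuity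
of the defect and, with `y₁ = y₂`, for the contraction step. -/
theorem LipschitzPsi.eLpNorm_le {Ω : Type*} [MeasureSpace Ω] {n : ℕ}
    {F : Ω → Euc n → Set (Euc n)} {a : Ω → Euc n} {α : ℝ} {M : Ω → ℝ} {q : ℝ≥0∞} (hq : 1 ≤ q)
    (h : LipschitzPsi F a α M) (hF_meas : ∀ x, MeasurableMultimap fun t => F t x)
    (hM : AEStronglyMeasurable M)
    {x₁ y₁ x₂ y₂ : Ω → Euc n} (hx₁ : AEMeasurable x₁) (hy₁ : AEMeasurable y₁)
    (hy₂ : AEMeasurable y₂)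
    (hxa₁ : ∀ᵐ t, x₁ t ∈ Metric.ball (a t) α) (hxa₂ : ∀ᵐ t, x₂ t ∈ Metric.ball (a t) α)
    {c : ℝ} (hc : ∀ᵐ t, ‖x₂ t - x₁ t‖ ≤ c) :
    eLpNorm (fun t => psi F t (x₂ t) (y₂ t)) q volume ≤
      eLpNorm (fun t => psi F t (x₁ t) (y₁ t)) q volume + eLpNorm (y₂ - y₁) q volume
        + ENNReal.ofReal c * eLpNorm M q volume := by
  have hm1 := (h.aemeasurable hF_meas hx₁ hy₁ hxa₁).aestronglyMeasurable
  have hm2 : AEStronglyMeasurable (fun t => ‖y₂ t - y₁ t‖ₑ) :=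
    (hy₂.sub hy₁).enorm.aestronglyMeasurable
  have hm3 : AEStronglyMeasurable (fun t => ‖c • M t‖ₑ) :=
    (hM.const_smul c).enorm.aestronglyMeasurable
  have hmono : eLpNorm (fun t => psi F t (x₂ t) (y₂ t)) q volume ≤
      eLpNorm (((fun t => psi F t (x₁ t) (y₁ t)) + fun t => ‖y₂ t - y₁ t‖ₑ)
        + fun t => ‖c • M t‖ₑ) q volume := by
    apply eLpNorm_mono_enorm_ae
    filter_upwards [h, hxa₁, hxa₂, hc] with t ht h1 h2 h3
    simp only [Pi.add_apply, enorm_eq_self]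
    refine ((ht _ (Metric.ball_subset_closedBall h2) (y₂ t)).2 _
      (Metric.ball_subset_closedBall h1) (y₁ t)).trans ?_
    rw [edist_eq_enorm_sub, enorm_smul, mul_comm]
    gcongr
    rw [edist_dist, dist_eq_norm, ← ofReal_norm]
    exact ENNReal.ofReal_le_ofReal (h3.trans (Real.le_norm_self _))
  -- A negative `c` is compatible with `hc` only if the measure is zero.
  by_cases hne : ∃ t : Ω, 0 ≤ c
  · obtain ⟨-, hc0⟩ := hne
    calc _ ≤ _ := hmono
      _ ≤ _ := eLpNorm_add_le (hm1.add hm2) hm3 hq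
      _ ≤ _ := by
        gcongr ?_ + ?_
        · refine (eLpNorm_add_le hm1 hm2 hq).trans_eq ?_
          rw [eLpNorm_enorm (fun t => y₂ t - y₁ t)]
          rfl
        · rw [eLpNorm_enorm (fun t => c • M t)]
          refine (eLpNorm_const_smul c M q _).trans_le ?_
          rw [← ofReal_norm, Real.norm_of_nonneg hc0]
  · have hvol : (volume : Measure Ω) = 0 := by
      rw [← ae_eq_bot, ← eventually_false_iff_eq_bot]
      filter_upwards [hc] with t ht
      exact hne ⟨t, (norm_nonneg _).trans ht⟩
    simp [hvol]

/-! ### The error bound for the inclusion -/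

section Trajectories

variable {n : ℕ} {t₀ T p : ℝ}

theorem volume_segment_ne_top : volume (univ : Set (Icc t₀ T)) ≠ ⊤ := by
  rw [Measure.Subtype.volume_univ measurableSet_Icc.nullMeasurableSet, Real.volume_Icc]
  exact ENNReal.ofReal_ne_top

/-- The `L_p` norm of the violation of the inclusion `u(t) ∈ F(t, (Au)(t))`. -/
noncomputable def defect (A : LpSeg n t₀ T p → CSeg n t₀ T) (F : Icc t₀ T → Euc n → Set (Euc n))
    (u : LpSeg n t₀ T p) : ℝ≥0∞ :=
  eLpNorm (fun t => psi F t (A u t) (u t)) (ENNReal.ofReal p) volume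

theorem defect_eq_lintegral (hp : 1 ≤ p) (A : LpSeg n t₀ T p → CSeg n t₀ T)
    (F : Icc t₀ T → Euc n → Set (Euc n)) (u : LpSeg n t₀ T p) :
    defect A F u = (∫⁻ t : Icc t₀ T, psi F t (A u t) (u t) ^ p) ^ (1 / p) := by
  have hp0 : 0 < p := by linarith
  rw [defect, eLpNorm_eq_lintegral_rpow_enorm_toReal (by simpa using hp0) ENNReal.ofReal_ne_top,
    ENNReal.toReal_ofReal hp0.le]
  rfl

theorem SolvesInclusion.lintegral_eq_zero (hp : 1 ≤ p) {A : LpSeg n t₀ T p → CSeg n t₀ T}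
    {F : Icc t₀ T → Euc n → Set (Euc n)} {u : LpSeg n t₀ T p} (h : SolvesInclusion A F u) :
    (∫⁻ t : Icc t₀ T, psi F t (A u t) (u t) ^ p) ^ (1 / p) = 0 := by
  have hp0 : 0 < p := by linarith
  have : ∫⁻ t : Icc t₀ T, psi F t (A u t) (u t) ^ p = ∫⁻ _ : Icc t₀ T, 0 := by
    apply lintegral_congr_ae
    filter_upwards [h] with t ht
    rw [psi, Metric.infEDist_zero_of_mem ht, ENNReal.zero_rpow_of_pos hp0]
  rw [this, lintegral_zero, ENNReal.zero_rpow_of_pos (by positivity)]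

variable {A : LpSeg n t₀ T p → CSeg n t₀ T} {F : Icc t₀ T → Euc n → Set (Euc n)}
  {ubar : LpSeg n t₀ T p} {M : Icc t₀ T → ℝ} {α L : ℝ}

theorem trajectory_mem_ball [Fact (1 ≤ ENNReal.ofReal p)] (hL : 0 < L)
    (hA_lip : ∀ (u v : LpSeg n t₀ T p) (t : Icc t₀ T), ‖A u t - A v t‖ ≤ L * ‖u - v‖)
    {u : LpSeg n t₀ T p} (hu : u ∈ Metric.ball ubar (α / L)) (t : Icc t₀ T) :
    A u t ∈ Metric.ball (A ubar t) α := by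
  rw [Metric.mem_ball, dist_eq_norm, lt_div_iff₀' hL] at *
  exact (hA_lip u ubar t).trans_lt hu

theorem defect_le_add [Fact (1 ≤ ENNReal.ofReal p)] (hL : 0 < L)
    (hA_lip : ∀ (u v : LpSeg n t₀ T p) (t : Icc t₀ T), ‖A u t - A v t‖ ≤ L * ‖u - v‖)
    (hM : MemLp M (ENNReal.ofReal p) volume)
    (hF_meas : ∀ x, MeasurableMultimap fun t => F t x) (hψ : LipschitzPsi F (A ubar) α M)
    {u v : LpSeg n t₀ T p} (hu : u ∈ Metric.ball ubar (α / L))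
    (hv : v ∈ Metric.ball ubar (α / L)) :
    defect A F v ≤ defect A F u
      + ENNReal.ofReal ((1 + L * lpNorm M (ENNReal.ofReal p) volume) * ‖v - u‖) := by
  refine (hψ.eLpNorm_le Fact.out hF_meas hM.1 (x₁ := A u) (y₁ := u) (x₂ := A v) (y₂ := v)
    (A u).continuous.aemeasurable (Lp.aestronglyMeasurable u).aemeasurable
    (Lp.aestronglyMeasurable v).aemeasurable (ae_of_all _ (trajectory_mem_ball hL hA_lip hu))
    (ae_of_all _ (trajectory_mem_ball hL hA_lip hv)) (ae_of_all _ (hA_lip v u))).trans ?_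
  have h0 : 0 ≤ lpNorm M (ENNReal.ofReal p) volume := lpNorm_nonneg
  rw [add_assoc, ← ofReal_lpNorm hM, ← ENNReal.ofReal_mul (by positivity),
    ← eLpNorm_congr_ae (Lp.coeFn_sub v u), ← Lp.enorm_def, ← ofReal_norm,
    ← ENNReal.ofReal_add (by positivity) (by positivity)]
  refine add_le_add le_rfl (ENNReal.ofReal_le_ofReal (le_of_eq ?_))
  ring

/-- One Filippov step. The new control is almost a selection of `F` along the old trajectory, so
apart from the slack `δ` its defect comes only from the motion of the trajectory. -/
theorem exists_defect_le [Fact (1 ≤ ENNReal.ofReal p)] (hL : 0 < L)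
    (hA_lip : ∀ (u v : LpSeg n t₀ T p) (t : Icc t₀ T), ‖A u t - A v t‖ ≤ L * ‖u - v‖)
    (hM : MemLp M (ENNReal.ofReal p) volume)
    (hF_meas : ∀ x, MeasurableMultimap fun t => F t x) (hψ : LipschitzPsi F (A ubar) α M)
    {u : LpSeg n t₀ T p} {d δ : ℝ} (hd : defect A F u = ENNReal.ofReal d) (hd0 : 0 ≤ d)
    (hδ : 0 < δ) (hu : ‖u - ubar‖ + (d + δ) < α / L) :
    ∃ v : LpSeg n t₀ T p, ‖v - u‖ ≤ d + δ ∧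
      defect A F v ≤
        ENNReal.ofReal (δ + L * lpNorm M (ENNReal.ofReal p) volume * (d + δ)) := by
  have hq : 1 ≤ ENNReal.ofReal p := Fact.out
  have hubar : u ∈ Metric.ball ubar (α / L) := by
    rw [Metric.mem_ball, dist_eq_norm]; linarith
  have hAu := trajectory_mem_ball hL hA_lip hubar
  have hum := (Lp.aestronglyMeasurable u).aemeasurable
  have hAum : AEMeasurable (A u) := (A u).continuous.aemeasurable
  -- The segment has finite measure, so a small constant pointwise error has `L_p` norm at most `δ`.
  obtain ⟨ε, hε0, hε⟩ := ENNReal.exists_nnreal_pos_mul_lt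
    (a := volume (univ : Set (Icc t₀ T)) ^ (1 / (ENNReal.ofReal p).toReal))
    (b := ENNReal.ofReal δ) (ENNReal.rpow_ne_top_of_nonneg (by positivity) volume_segment_ne_top)
    (by simpa using hδ)
  have hεδ : eLpNorm (fun _ : Icc t₀ T => (ε : ℝ≥0∞)) (ENNReal.ofReal p) volume
      ≤ ENNReal.ofReal δ := by
    rw [eLpNorm_const' _ (zero_lt_one.trans_le hq).ne' ENNReal.ofReal_ne_top]
    exact hε.le
  obtain ⟨w, hw, hwt⟩ := exists_measurable_almost_nearest (Γ := fun t => F t (A u t))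
    (fun y hy => hψ.aemeasurable hF_meas hAum hy (ae_of_all _ hAu)) hum
    (by
      filter_upwards [hψ] with t ht
      exact (ht _ (Metric.ball_subset_closedBall (hAu t)) _).1)
    (ENNReal.coe_ne_zero.2 hε0.ne')
  have hψm := (hψ.aemeasurable hF_meas hAum hum (ae_of_all _ hAu)).aestronglyMeasurable
  have hwu : eLpNorm (w - ⇑u) (ENNReal.ofReal p) volume ≤ ENNReal.ofReal (d + δ) := by
    calc eLpNorm (w - ⇑u) (ENNReal.ofReal p) volume
        ≤ eLpNorm ((fun t => psi F t (A u t) (u t)) + fun _ => (ε : ℝ≥0∞))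
          (ENNReal.ofReal p) volume := by
          apply eLpNorm_mono_enorm_ae
          filter_upwards [hwt] with t ht
          rw [Pi.sub_apply, ← edist_eq_enorm_sub]
          exact ht.1
      _ ≤ _ := eLpNorm_add_le hψm aestronglyMeasurable_const hq
      _ ≤ ENNReal.ofReal d + ENNReal.ofReal δ := add_le_add hd.le hεδ
      _ = _ := (ENNReal.ofReal_add hd0 hδ.le).symm
  have hwLp : MemLp w (ENNReal.ofReal p) volume := by
    have h1 : MemLp (w - ⇑u) (ENNReal.ofReal p) volume :=
      ⟨(hw.aemeasurable.sub hum).aestronglyMeasurable, hwu.trans_lt ENNReal.ofReal_lt_top⟩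
    simpa using h1.add (Lp.memLp u)
  let v : LpSeg n t₀ T p := hwLp.toLp w
  have hvw : v =ᵐ[volume] w := hwLp.coeFn_toLp
  have hvu : ‖v - u‖ ≤ d + δ := by
    have h1 : eLpNorm (v - u : LpSeg n t₀ T p) (ENNReal.ofReal p) volume
        = eLpNorm (w - ⇑u) (ENNReal.ofReal p) volume :=
      eLpNorm_congr_ae ((Lp.coeFn_sub v u).trans (hvw.sub ae_eq_rfl))
    rw [Lp.norm_def, h1]
    exact ENNReal.toReal_le_of_le_ofReal (by positivity) hwu
  have hv : v ∈ Metric.ball ubar (α / L) := by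
    rw [Metric.mem_ball, dist_eq_norm]
    linarith [norm_sub_le_norm_sub_add_norm_sub v u ubar]
  refine ⟨v, hvu, ?_⟩
  have h1 : eLpNorm (fun t => psi F t (A u t) (v t)) (ENNReal.ofReal p) volume
      ≤ ENNReal.ofReal δ := by
    refine le_trans ?_ hεδ
    apply eLpNorm_mono_enorm_ae
    filter_upwards [hwt, hvw] with t ht hvt
    rw [hvt]
    exact ht.2
  have h2 := hψ.eLpNorm_le hq hF_meas hM.1 (x₁ := A u) (y₁ := v) (x₂ := A v) (y₂ := v) hAum
    (Lp.aestronglyMeasurable v).aemeasurable (Lp.aestronglyMeasurable v).aemeasurable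
    (ae_of_all _ hAu) (ae_of_all _ (trajectory_mem_ball hL hA_lip hv))
    (c := L * (d + δ)) (ae_of_all _ fun t => (hA_lip v u t).trans (by gcongr))
  refine h2.trans ?_
  have h0 : 0 ≤ lpNorm M (ENNReal.ofReal p) volume := lpNorm_nonneg
  rw [sub_self, eLpNorm_zero, add_zero, ← ofReal_lpNorm hM, ← ENNReal.ofReal_mul (by positivity)]
  refine (add_le_add_left h1 _).trans ?_
  rw [← ENNReal.ofReal_add hδ.le (by positivity)]
  exact ENNReal.ofReal_le_ofReal (le_of_eq (by ring))

/-- Near a solution of the inclusion, the distance to the set of solutions is bounded by a multiple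
of the defect. -/
theorem exists_solvesInclusion_near [Fact (1 ≤ ENNReal.ofReal p)] (hL : 0 < L) (hα : 0 < α)
    (hA_lip : ∀ (u v : LpSeg n t₀ T p) (t : Icc t₀ T), ‖A u t - A v t‖ ≤ L * ‖u - v‖)
    (hM : MemLp M (ENNReal.ofReal p) volume)
    (hLM : L * lpNorm M (ENNReal.ofReal p) volume < 1)
    (hF_compact : ∀ t x, IsCompact (F t x))
    (hF_meas : ∀ x, MeasurableMultimap fun t => F t x) (hψ : LipschitzPsi F (A ubar) α M)
    (hubar : defect A F ubar = 0) {u : LpSeg n t₀ T p}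
    (hu : ‖u - ubar‖ + 4 / (1 - L * lpNorm M (ENNReal.ofReal p) volume) *
      ((1 + L * lpNorm M (ENNReal.ofReal p) volume) * ‖u - ubar‖) < α / L) :
    defect A F u ≠ ⊤ ∧ ∃ v, v ∈ Metric.ball ubar (α / L) ∧ SolvesInclusion A F v ∧
      ‖v - u‖ ≤ 4 / (1 - L * lpNorm M (ENNReal.ofReal p) volume) * (defect A F u).toReal := by
  have hm0 : 0 ≤ L * lpNorm M (ENNReal.ofReal p) volume := mul_nonneg hL.le lpNorm_nonneg
  set m := L * lpNorm M (ENNReal.ofReal p) volume with hm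
  have hm1 : 0 < 1 - m := by linarith
  have hb : ubar ∈ Metric.ball ubar (α / L) := Metric.mem_ball_self (by positivity)
  have hbound : ∀ w ∈ Metric.ball ubar (α / L),
      defect A F w ≤ ENNReal.ofReal ((1 + m) * ‖w - ubar‖) := fun w hw => by
    simpa [hubar] using defect_le_add hL hA_lip hM hF_meas hψ hb hw
  have hfin : ∀ w ∈ Metric.ball ubar (α / L), defect A F w ≠ ⊤ := fun w hw =>
    ((hbound w hw).trans_lt ENNReal.ofReal_lt_top).ne
  have hlip : LipschitzOnWith (1 + m).toNNReal (fun w => (defect A F w).toReal)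
      (Metric.ball ubar (α / L)) := by
    refine LipschitzOnWith.of_le_add_mul _ fun x hx y hy => ?_
    have h := ENNReal.toReal_mono (by simp [hfin y hy])
      (defect_le_add hL hA_lip hM hF_meas hψ hy hx)
    rw [ENNReal.toReal_add (hfin y hy) ENNReal.ofReal_ne_top,
      ENNReal.toReal_ofReal (by positivity)] at h
    rwa [Real.coe_toNNReal _ (by positivity), dist_eq_norm]
  have hub : u ∈ Metric.ball ubar (α / L) := by
    rw [Metric.mem_ball, dist_eq_norm]
    have : 0 ≤ 4 / (1 - m) * ((1 + m) * ‖u - ubar‖) := by positivity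
    linarith
  -- The ratio `(1 + m) / 2` lies midway between the ideal factor `m` and `1`, leaving room for
  -- inexact selections.
  have hq : 2 / (1 - (1 + m) / 2) = 4 / (1 - m) := by
    have : 1 - (1 + m) / 2 = (1 - m) / 2 := by ring
    rw [this]; field_simp; norm_num
  obtain ⟨v, hv, hv0, huv⟩ := exists_zero_of_contracting_steps (c := ubar) (R := α / L)
    (q := (1 + m) / 2) (by positivity) (by linarith) (D := fun w => (defect A F w).toReal)
    (fun _ => ENNReal.toReal_nonneg) hlip.continuousOn
    (by
      intro w hw
      rw [hq] at hw
      have hd0 : 0 ≤ (defect A F w).toReal := ENNReal.toReal_nonneg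
      have h4 : 2 * (defect A F w).toReal ≤ 4 / (1 - m) * (defect A F w).toReal := by
        gcongr
        rw [le_div_iff₀ hm1]; linarith
      have hwb : w ∈ Metric.ball ubar (α / L) := by rw [Metric.mem_ball]; linarith
      have hd := (ENNReal.ofReal_toReal (hfin w hwb)).symm
      generalize (defect A F w).toReal = d at *
      -- The slack is proportional to `d` and must be positive, so zero defect is treated apart: the
      -- point itself serves.
      rcases hd0.eq_or_lt with h0 | h0
      · exact ⟨w, by simp [hd, ← h0]⟩
      -- With `δ = (1 - m) / 4 * d` the step is at most `2 * d`, and `δ + m * (d + δ)` falls short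
      -- of `(1 + m) / 2 * d` by `(1 - m)^2 / 4 * d`.
      have hδ : (1 - m) / 4 * d ≤ d := mul_le_of_le_one_left hd0 (by linarith)
      obtain ⟨w', h1, h2⟩ := exists_defect_le (δ := (1 - m) / 4 * d) hL hA_lip hM hF_meas hψ hd
        hd0 (by positivity) (by rw [← dist_eq_norm]; linarith)
      refine ⟨w', by rw [dist_comm, dist_eq_norm]; linarith, ?_⟩
      refine (ENNReal.toReal_le_of_le_ofReal (by positivity) h2).trans ?_
      rw [← hm]
      nlinarith [mul_nonneg (mul_nonneg hm1.le hm1.le) hd0])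
    (by
      rw [hq, dist_eq_norm]
      refine lt_of_le_of_lt ?_ hu
      gcongr
      exact ENNReal.toReal_le_of_le_ofReal (by positivity) (hbound u hub))
  refine ⟨hfin u hub, v, hv, ?_, ?_⟩
  · have h0 : defect A F v = 0 := by
      simpa [ENNReal.toReal_eq_zero_iff, hfin v hv] using hv0
    have hq1 : 1 ≤ ENNReal.ofReal p := Fact.out
    have hmeas := hψ.aemeasurable hF_meas (A v).continuous.aemeasurable
      (Lp.aestronglyMeasurable v).aemeasurable (ae_of_all _ (trajectory_mem_ball hL hA_lip hv))
    have hae := (eLpNorm_eq_zero_iff hmeas.aestronglyMeasurable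
      (zero_lt_one.trans_le hq1).ne').1 h0
    filter_upwards [hae] with t ht
    exact (Metric.mem_iff_infEDist_zero_of_closed (hF_compact _ _).isClosed).2 ht
  · rw [hq, dist_comm, dist_eq_norm] at huv
    exact huv

end Trajectories

/-! ### Lipschitz estimate of the objective, and the radius of the ball -/

section Objective

variable {n : ℕ} {t₀ T p : ℝ}

/-- Integrates the Lipschitz bound of `f`; Hölder on the finite segment gives `‖w‖₁ ≤ |T - t₀|^(1 -
1/p) ‖w‖_p`. -/
theorem lintegral_ofReal_mul_add_le [Fact (1 ≤ ENNReal.ofReal p)] {k : Icc t₀ T → ℝ}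
    (hk : MemLp k 1 volume) {k₁ c : ℝ} (hk₁ : 0 ≤ k₁) (hc : 0 ≤ c) (w : LpSeg n t₀ T p) :
    ∫⁻ t, ENNReal.ofReal (‖k t‖ * c + k₁ * ‖w t‖) ≤
      ENNReal.ofReal (lpNorm k 1 volume * c + k₁ * ((volume (univ : Set (Icc t₀ T)) ^
        (1 / (1 : ℝ≥0∞).toReal - 1 / (ENNReal.ofReal p).toReal)).toReal * ‖w‖)) := by
  have hp : 1 ≤ ENNReal.ofReal p := Fact.out
  have hp' : 1 ≤ (ENNReal.ofReal p).toReal := by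
    simpa using ENNReal.toReal_mono ENNReal.ofReal_ne_top hp
  have hwm := Lp.aestronglyMeasurable w
  have hk0 : 0 ≤ lpNorm k 1 volume := lpNorm_nonneg
  have hexp : 0 ≤ 1 / (1 : ℝ≥0∞).toReal - 1 / (ENNReal.ofReal p).toReal := by
    rw [ENNReal.toReal_one, one_div_one, sub_nonneg, div_le_one (by linarith)]
    exact hp'
  have hV := ENNReal.rpow_ne_top_of_nonneg hexp (volume_segment_ne_top (t₀ := t₀) (T := T))
  have hw := eLpNorm_le_eLpNorm_mul_rpow_measure_univ hp hwm
  rw [eLpNorm_one_eq_lintegral_enorm, ← Lp.enorm_def, ← ofReal_norm] at hw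
  calc ∫⁻ t, ENNReal.ofReal (‖k t‖ * c + k₁ * ‖w t‖)
      = ∫⁻ t, (‖k t‖ₑ * ENNReal.ofReal c + ENNReal.ofReal k₁ * ‖w t‖ₑ) := by
        congr with t
        rw [ENNReal.ofReal_add (by positivity) (by positivity),
          ENNReal.ofReal_mul (norm_nonneg _), ENNReal.ofReal_mul hk₁, ofReal_norm, ofReal_norm]
    _ = (∫⁻ t, ‖k t‖ₑ) * ENNReal.ofReal c + ENNReal.ofReal k₁ * ∫⁻ t, ‖w t‖ₑ := by
        rw [lintegral_add_right' _ (hwm.enorm.const_mul _), lintegral_mul_const'' _ hk.1.enorm,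
          lintegral_const_mul'' _ hwm.enorm]
    _ ≤ ENNReal.ofReal (lpNorm k 1 volume) * ENNReal.ofReal c + ENNReal.ofReal k₁ *
        (ENNReal.ofReal ‖w‖ * ENNReal.ofReal ((volume (univ : Set (Icc t₀ T)) ^
          (1 / (1 : ℝ≥0∞).toReal - 1 / (ENNReal.ofReal p).toReal)).toReal)) := by
        rw [ofReal_lpNorm hk, eLpNorm_one_eq_lintegral_enorm, ENNReal.ofReal_toReal hV]
        gcongr
    _ = _ := by
        rw [← ENNReal.ofReal_mul hk0, ← ENNReal.ofReal_mul (norm_nonneg _),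
          ← ENNReal.ofReal_mul hk₁, ← ENNReal.ofReal_add (by positivity) (by positivity),
          mul_comm ‖w‖]

/-- The objective is Lipschitz along controls whose trajectories stay near that of `ubar`. -/
theorem exists_objective_le_add [Fact (1 ≤ ENNReal.ofReal p)] (hT : t₀ < T)
    {A : LpSeg n t₀ T p → CSeg n t₀ T} {φ : Euc n → Euc n → EReal}
    {f : Icc t₀ T → Euc n → Euc n → EReal} {ubar : LpSeg n t₀ T p} {k : Icc t₀ T → ℝ}
    (hk : MemLp k 1 volume) {k₁ k₂ α L : ℝ} (hk₁ : 0 < k₁) (hk₂ : 0 < k₂) (hL : 0 < L)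
    (hφ_lip : ∀ z₁ ∈ Metric.closedBall (A ubar ⟨t₀, left_mem_Icc.2 hT.le⟩) α,
      ∀ z₂ ∈ Metric.closedBall (A ubar ⟨t₀, left_mem_Icc.2 hT.le⟩) α,
      ∀ w₁ ∈ Metric.closedBall (A ubar ⟨T, right_mem_Icc.2 hT.le⟩) α,
      ∀ w₂ ∈ Metric.closedBall (A ubar ⟨T, right_mem_Icc.2 hT.le⟩) α,
        φ z₂ w₂ ≤ φ z₁ w₁ + ((k₂ * (‖z₂ - z₁‖ + ‖w₂ - w₁‖) : ℝ) : EReal))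
    (hf_lip : ∀ᵐ t : Icc t₀ T, ∀ x₁ ∈ Metric.closedBall (A ubar t) α,
      ∀ x₂ ∈ Metric.closedBall (A ubar t) α, ∀ y₁ y₂ : Euc n,
        f t x₁ y₁ ≤ f t x₂ y₂ + ((k t * ‖x₁ - x₂‖ + k₁ * ‖y₁ - y₂‖ : ℝ) : EReal))
    (hA_lip : ∀ (u v : LpSeg n t₀ T p) (t : Icc t₀ T), ‖A u t - A v t‖ ≤ L * ‖u - v‖) :
    ∃ C : ℝ, 0 ≤ C ∧ ∀ u ∈ Metric.ball ubar (α / L), ∀ v ∈ Metric.ball ubar (α / L),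
      objective hT A φ f v ≤ objective hT A φ f u + ((C * ‖v - u‖ : ℝ) : EReal) := by
  set V := (volume (univ : Set (Icc t₀ T)) ^
    (1 / (1 : ℝ≥0∞).toReal - 1 / (ENNReal.ofReal p).toReal)).toReal
  have hV : 0 ≤ V := ENNReal.toReal_nonneg
  have hk0 : 0 ≤ lpNorm k 1 volume := lpNorm_nonneg
  -- The first term comes from the two endpoints; the factor `2` in the second is that of
  -- `extIntegral_le_add`.
  refine ⟨k₂ * (L + L) + 2 * (lpNorm k 1 volume * L + k₁ * V), by positivity,
    fun u hu v hv => ?_⟩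
  have hAu := fun t => Metric.ball_subset_closedBall (trajectory_mem_ball hL hA_lip hu t)
  have hAv := fun t => Metric.ball_subset_closedBall (trajectory_mem_ball hL hA_lip hv t)
  have hint : extIntegral (fun t => f t (A v t) (v t)) ≤ extIntegral (fun t => f t (A u t) (u t)) +
      ((2 * (lpNorm k 1 volume * (L * ‖v - u‖) + k₁ * (V * ‖v - u‖)) : ℝ) : EReal) := by
    refine extIntegral_le_add (ℓ := fun t => ‖k t‖ * (L * ‖v - u‖) +
      k₁ * ‖(v - u : LpSeg n t₀ T p) t‖)
      ?_ (by positivity) (lintegral_ofReal_mul_add_le hk hk₁.le (by positivity) (v - u)) ?_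
    · exact (hk.1.norm.aemeasurable.mul_const _).add
        ((Lp.aestronglyMeasurable (v - u)).norm.aemeasurable.const_mul _)
    · filter_upwards [hf_lip, Lp.coeFn_sub v u] with t ht hsub
      refine (ht _ (hAv t) _ (hAu t) (v t) (u t)).trans ?_
      refine add_le_add le_rfl (EReal.coe_le_coe_iff.2 ?_)
      rw [hsub, Pi.sub_apply]
      gcongr
      · exact Real.le_norm_self _
      · exact hA_lip v u t
  have hend : φ (A v ⟨t₀, left_mem_Icc.2 hT.le⟩) (A v ⟨T, right_mem_Icc.2 hT.le⟩) ≤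
      φ (A u ⟨t₀, left_mem_Icc.2 hT.le⟩) (A u ⟨T, right_mem_Icc.2 hT.le⟩) +
        ((k₂ * (L * ‖v - u‖ + L * ‖v - u‖) : ℝ) : EReal) := by
    refine (hφ_lip _ (hAu _) _ (hAv _) _ (hAu _) _ (hAv _)).trans ?_
    refine add_le_add le_rfl (EReal.coe_le_coe_iff.2 ?_)
    gcongr
    · exact hA_lip v u _
    · exact hA_lip v u _
  refine (upperAdd_le_upperAdd_add_coe hend hint).trans_eq ?_
  unfold objective
  congr 2
  ring

/-- Since `p̃ ≥ p - 1`, the exponent is at least `2`. The error bound needs only the factor `4`. -/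
theorem nine_le_three_rpow (hp : 1 ≤ p) : (9 : ℝ) ≤ 3 ^ ((2 * pTilde p + 2) / p) := by
  have hp0 : 0 < p := by linarith
  have h1 : p - 1 ≤ pTilde p := by
    unfold pTilde
    split_ifs <;> linarith
  have h2 : (2 : ℝ) ≤ (2 * pTilde p + 2) / p := by
    rw [le_div_iff₀ hp0]; linarith
  calc (9 : ℝ) = 3 ^ (2 : ℝ) := by norm_num
    _ ≤ _ := Real.rpow_le_rpow_of_exponent_le (by norm_num) h2

/-- Here `s = ‖u - ubar‖`, and `(1 + m) * s` bounds the defect of `u`, so the left side bounds how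
far the iteration can travel from `ubar`. The summand `+ 1` in the bound on `β` makes the inequality
strict. -/
theorem norm_add_lt_of_radius_le {m L α β s κ : ℝ} (hm0 : 0 ≤ m) (hm1 : m < 1) (hL : 0 < L)
    (hα : 0 < α) (hκ : 4 ≤ κ) (hβ : L * κ * (m + 1) / (1 - m) + L + 1 ≤ β) (hs : s ≤ α / β) :
    s + 4 / (1 - m) * ((1 + m) * s) < α / L := by
  have h1 : 0 < 1 - m := by linarith
  have hX : L * (1 + 4 * (m + 1) / (1 - m)) < β := by
    have : L * (4 * (m + 1) / (1 - m)) ≤ L * κ * (m + 1) / (1 - m) := by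
      rw [show L * κ * (m + 1) / (1 - m) = L * (κ * (m + 1) / (1 - m)) by ring]
      gcongr
    linarith
  have hβ0 : 0 < β := lt_of_le_of_lt (by positivity) hX
  have hs' : s * β ≤ α := (le_div_iff₀ hβ0).1 hs
  have hα' : α / β * β = α := div_mul_cancel₀ _ hβ0.ne'
  have hαβ : 0 < α / β := by positivity
  rw [lt_div_iff₀' hL]
  calc L * (s + 4 / (1 - m) * ((1 + m) * s)) = L * (1 + 4 * (m + 1) / (1 - m)) * s := by
        field_simp; ring
    _ ≤ L * (1 + 4 * (m + 1) / (1 - m)) * (α / β) := by gcongr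
    _ < β * (α / β) := by gcongr
    _ = α := by rw [mul_comm, hα']

end Objective

/-! ### Exact penalization -/

theorem mainTheorem7 {n : ℕ} {t₀ T p : ℝ} (hT : t₀ < T) (hp : 1 ≤ p)
    (A : LpSeg n t₀ T p → CSeg n t₀ T)
    (φ : Euc n → Euc n → EReal) (hφ : ∀ z w, φ z w ≠ ⊥)
    (f : Icc t₀ T → Euc n → Euc n → EReal) (hf : IsNormalIntegrand f)
    (F : Icc t₀ T → Euc n → Set (Euc n))
    (hF_compact : ∀ t x, IsCompact (F t x))
    (hF_meas : ∀ x, MeasurableMultimap fun t => F t x)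
    (ubar : LpSeg n t₀ T p) (hubar : SolvesExtremalProblem hT A φ f F ubar)
    (k M : Icc t₀ T → ℝ) (hk : MemLp k 1 volume) (hM : MemLp M (ENNReal.ofReal p) volume)
    (k₁ k₂ α L : ℝ) (hk₁ : 0 < k₁) (hk₂ : 0 < k₂) (hα : 0 < α) (hL : 0 < L)
    -- the closed `α`-ball around `(A ubar)(t)` lies in the domain of `F(t, ·)`
    (hF_dom : ∀ᵐ t : Icc t₀ T, ∀ x ∈ Metric.closedBall (A ubar t) α, (F t x).Nonempty)
    -- Lipschitz conditions; the two points may be exchanged in the first two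
    (hφ_lip : ∀ z₁ ∈ Metric.closedBall (A ubar ⟨t₀, left_mem_Icc.2 hT.le⟩) α,
      ∀ z₂ ∈ Metric.closedBall (A ubar ⟨t₀, left_mem_Icc.2 hT.le⟩) α,
      ∀ w₁ ∈ Metric.closedBall (A ubar ⟨T, right_mem_Icc.2 hT.le⟩) α,
      ∀ w₂ ∈ Metric.closedBall (A ubar ⟨T, right_mem_Icc.2 hT.le⟩) α,
        φ z₂ w₂ ≤ φ z₁ w₁ + ((k₂ * (‖z₂ - z₁‖ + ‖w₂ - w₁‖) : ℝ) : EReal))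
    (hf_lip : ∀ᵐ t : Icc t₀ T, ∀ x₁ ∈ Metric.closedBall (A ubar t) α,
      ∀ x₂ ∈ Metric.closedBall (A ubar t) α, ∀ y₁ y₂ : Euc n,
        f t x₁ y₁ ≤ f t x₂ y₂ + ((k t * ‖x₁ - x₂‖ + k₁ * ‖y₁ - y₂‖ : ℝ) : EReal))
    (hF_lip : ∀ᵐ t : Icc t₀ T, ∀ x₁ ∈ Metric.closedBall (A ubar t) α,
      ∀ x₂ ∈ Metric.closedBall (A ubar t) α,
        Metric.hausdorffDist (F t x₁) (F t x₂) ≤ M t * ‖x₁ - x₂‖)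
    (hA_lip : ∀ (u v : LpSeg n t₀ T p) (t : Icc t₀ T), ‖A u t - A v t‖ ≤ L * ‖u - v‖)
    (hLM : L * lpNorm M (ENNReal.ofReal p) volume < 1) :
    ∃ r₀ : ℝ, 0 < r₀ ∧ ∀ β : ℝ,
      L * (3 : ℝ) ^ ((2 * pTilde p + 2) / p) * (L * lpNorm M (ENNReal.ofReal p) volume + 1)
          / (1 - L * lpNorm M (ENNReal.ofReal p) volume) + L + 1 ≤ β →
      ∀ r : ℝ, r₀ ≤ r → ∀ u : LpSeg n t₀ T p, ‖u - ubar‖ ≤ α / β →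
        penalized hT A φ f F r ubar ≤ penalized hT A φ f F r u := by
  have : Fact (1 ≤ ENNReal.ofReal p) := ⟨by simpa using hp⟩
  have hm0 : 0 ≤ L * lpNorm M (ENNReal.ofReal p) volume := mul_nonneg hL.le lpNorm_nonneg
  have hψ := lipschitzPsi_of_hausdorffDist_le hF_compact hF_dom hF_lip
  obtain ⟨C, hC0, hC⟩ := exists_objective_le_add hT hk hk₁ hk₂ hL hφ_lip hf_lip hA_lip
  have hzero := hubar.solves.lintegral_eq_zero hp
  have hpen : ∀ r : ℝ, penalized hT A φ f F r ubar = objective hT A φ f ubar := fun r => by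
    rw [penalized, hzero]
    simpa using upperAdd_coe (objective hT A φ f ubar) 0
  have hm1 : 0 < 1 - L * lpNorm M (ENNReal.ofReal p) volume := by linarith
  -- Lipschitz constant of the objective times the constant of the error bound; `+ 1` only ensures
  -- positivity when `C = 0`.
  refine ⟨C * (4 / (1 - L * lpNorm M (ENNReal.ofReal p) volume)) + 1, by positivity,
    fun β hβ r hr u hu => ?_⟩
  have hs := norm_add_lt_of_radius_le hm0 hLM hL hα
    ((by norm_num : (4 : ℝ) ≤ 9).trans (nine_le_three_rpow hp)) hβ hu
  obtain ⟨hfin, v, hv, hvF, hvu⟩ := exists_solvesInclusion_near hL hα hA_lip hM hLM hF_compact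
    hF_meas hψ (by rw [defect_eq_lintegral hp]; exact hzero) hs
  have hub : u ∈ Metric.ball ubar (α / L) := by
    rw [Metric.mem_ball, dist_eq_norm]
    refine lt_of_le_of_lt (le_add_of_nonneg_right ?_) hs
    positivity
  -- The defect is finite, so the penalty is a real number and `upperAdd` reduces to ordinary
  -- addition.
  rw [hpen, penalized, ← defect_eq_lintegral hp, ← ENNReal.ofReal_toReal hfin,
    EReal.coe_ennreal_ofReal, max_eq_left ENNReal.toReal_nonneg, ← EReal.coe_mul, upperAdd_coe]
  refine (hubar.le_of_solves v hvF).trans ((hC u hub v hv).trans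
    (add_le_add le_rfl (EReal.coe_le_coe_iff.2 ?_)))
  calc C * ‖v - u‖
      ≤ C * (4 / (1 - L * lpNorm M (ENNReal.ofReal p) volume) * (defect A F u).toReal) := by gcongr
    _ = C * (4 / (1 - L * lpNorm M (ENNReal.ofReal p) volume)) * (defect A F u).toReal := by ring
    _ ≤ r * (defect A F u).toReal := by
        gcongr
        linarith
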